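/- Let $\mathbb T\subseteq\mathbb R$ be a time scale (a closed set), let $a<b$ be points of $\mathbb T$, and put $I=[a,b]\cap\mathbb T$, regarded as a time scale with forward jump operator $\sigma$ (so $\sigma(b)=b$) and graininess $\mu(t)=\sigma(t)-t$; $I^{\kappa}$ is $I\setminus\{b\}$ if $b$ is left-scattered in $I$, and $I$ otherwise. Delta derivatives $X^\Delta$ of matrix functions on $I$ are taken entrywise. "Positive definite" means real symmetric with $z^TMz>0$ for all $z\ne0$, and $M\le N$ means $z^TMz\le z^TNz$ for all $z\in\mathbb R^n$. Let $S\subseteq\mathbb R^{n\times n}$ and let $F:I^\kappa\times S\to\mathbb R^{n\times n}$ be right-Hilger-continuous: $F$ is continuous at each $(t,X)$ with $t$ right-dense, and at each $(t,X)$ with $t$ left-dense the limits $\lim_{(s,Y)\to(t^-,X)}F(s,Y)$ and $\lim_{Y\to X}F(t,Y)$ exist. Let $B(t)$, $t\in I$, be positive definite matrices such that 1. $B$ is rd-continuous on $I$ (continuous at right-dense points, with finite left limits at left-dense points); 2. $e_B(t,a)$ commutes with $B(t)$ and with every $P\in S$, for all $t\in I$, where $e_B(t,a)=\exp\left(\int_a^t\xi(s)\,\Delta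 s\right)$ with $\xi(s)=B(s)$ if $\mu(s)=0$ and $\xi(s)=\mu(s)^{-1}\operatorname{Log}(I_n+\mu(s)B(s))$ if $\mu(s)>0$, $\operatorname{Log}$ being the principal logarithm and $I_n$ the identity matrix. Assume that any two different elements of $S$ can be named $P,Q$ so that $P-Q$ is positive definite, and that, whenever $P,Q\in S$ with $P-Q$ positive definite and $t\in I^\kappa$, writing $P^\Delta=F(t,P)$ and $Q^\Delta=F(t,Q)$, the difference is increasing, i.e. $P^\Delta-Q^\Delta$ is positive definite, and the inverse Lipschitz condition $$(P-Q)^{-1}\le (P^\Delta-Q^\Delta)^{-1}B(t)$$ holds. Then for every $A\in\mathbb R^{n\times n}$ the initial value problem $X^\Delta=F(t,X)$ on $I^\kappa$, $X(a)=A$, has at most one solution $X$ on $I$ with $X(t)\in S$ for all $t\in I$. -/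

import Mathlib

open Set Filter Topology

namespace TimeScale

open Classical in
/-- Forward jump operator `σ(t) = inf {s ∈ 𝕋 : s > t}`, with `σ(t) = t` if `t` is the maximum. -/
noncomputable def sigma (𝕋 : Set ℝ) (t : ℝ) : ℝ :=
  if (𝕋 ∩ Ioi t).Nonempty then sInf (𝕋 ∩ Ioi t) else t

open Classical in
/-- Backward jump operator `ρ(t) = sup {s ∈ 𝕋 : s < t}`, with `ρ(t) = t` if `t` is the minimum. -/
noncomputable def rho (𝕋 : Set ℝ) (t : ℝ) : ℝ :=
  if (𝕋 ∩ Iio t).Nonempty then sSup (𝕋 ∩ Iio t) else t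

/-- Graininess. -/
noncomputable def mu (𝕋 : Set ℝ) (t : ℝ) : ℝ := sigma 𝕋 t - t

/-- `t` is a right-dense point of `𝕋`: `t < sup 𝕋` and `σ(t) = t`. -/
def RightDense (𝕋 : Set ℝ) (t : ℝ) : Prop :=
  t ∈ 𝕋 ∧ (𝕋 ∩ Ioi t).Nonempty ∧ sigma 𝕋 t = t

/-- `t` is a left-dense point of `𝕋`: `t > inf 𝕋` and `ρ(t) = t`. -/
def LeftDense (𝕋 : Set ℝ) (t : ℝ) : Prop :=
  t ∈ 𝕋 ∧ (𝕋 ∩ Iio t).Nonempty ∧ rho 𝕋 t = t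

/-- `𝕋^κ`: the time scale without its left-scattered maximum, if it has one. -/
def kappa (𝕋 : Set ℝ) : Set ℝ :=
  {t | t ∈ 𝕋 ∧ ¬ (IsGreatest 𝕋 t ∧ rho 𝕋 t < t)}

/-- The time scale interval `[a,b]_𝕋`, itself a time scale. -/
def interval (𝕋 : Set ℝ) (a b : ℝ) : Set ℝ := 𝕋 ∩ Icc a b

/-- The real function `x` has delta derivative `d` at `t`. -/
def HasDeltaDerivAt (𝕋 : Set ℝ) (x : ℝ → ℝ) (d t : ℝ) : Prop :=
  ∀ ε > 0, ∃ δ > 0, ∀ s ∈ 𝕋, |s - t| < δ →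
    |(x (sigma 𝕋 t) - x s) - d * (sigma 𝕋 t - s)| ≤ ε * |sigma 𝕋 t - s|

/-- The matrix function `X` has delta derivative `D` at `t`: entrywise. -/
def HasMatrixDeltaDerivAt {n : ℕ} (𝕋 : Set ℝ) (X : ℝ → Matrix (Fin n) (Fin n) ℝ)
    (D : Matrix (Fin n) (Fin n) ℝ) (t : ℝ) : Prop :=
  ∀ i j, HasDeltaDerivAt 𝕋 (fun s => X s i j) (D i j) t

/-- Rd-continuity on `𝕋`: continuous at right-dense points, with (finite) left limits at
left-dense points. (The topology on matrices is the entrywise one.) -/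
def RdContinuous {E : Type*} [TopologicalSpace E] (𝕋 : Set ℝ) (f : ℝ → E) : Prop :=
  (∀ t, RightDense 𝕋 t → ContinuousWithinAt f 𝕋 t) ∧
  (∀ t, LeftDense 𝕋 t → ∃ l, Tendsto f (𝓝[𝕋 ∩ Iio t] t) (𝓝 l))

/-- Right-Hilger-continuity of `F : 𝕋^κ × S → E`: continuous at every `(t, x)` with `t`
right-dense; at every `(t, x)` with `t` left-dense the limits of `F(s, y)` as
`(s, y) → (t⁻, x)` and of `F(t, y)` as `y → x` exist. -/
def RightHilgerContinuous {E : Type*} [TopologicalSpace E] (𝕋 : Set ℝ) (S : Set E)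
    (F : ℝ → E → E) : Prop :=
  (∀ t ∈ kappa 𝕋, ∀ x ∈ S, RightDense 𝕋 t →
    ContinuousWithinAt (fun p : ℝ × E => F p.1 p.2) (kappa 𝕋 ×ˢ S) (t, x)) ∧
  (∀ t ∈ kappa 𝕋, ∀ x ∈ S, LeftDense 𝕋 t →
    (∃ l, Tendsto (fun p : ℝ × E => F p.1 p.2)
      (𝓝[(kappa 𝕋 ∩ Iio t) ×ˢ S] (t, x)) (𝓝 l)) ∧
    (∃ l, Tendsto (F t) (𝓝[S \ {x}] x) (𝓝 l)))

/-- The last point of `𝕋` that is not to the right of the real number `s`. -/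
noncomputable def floor (𝕋 : Set ℝ) (s : ℝ) : ℝ := sSup (𝕋 ∩ Iic s)

/-- The delta integral `∫_a^t f(s) Δs` for `a ≤ t` in `𝕋`: the integrand is extended to real
arguments as a constant on every gap `[r, σ(r))`, which therefore contributes `μ(r) f(r)`, while
the other points of `𝕋` are integrated against Lebesgue measure. -/
noncomputable def deltaIntegral (𝕋 : Set ℝ) (f : ℝ → ℝ) (a t : ℝ) : ℝ :=
  ∫ s in a..t, f (floor 𝕋 s)

open Classical in
/-- The cylinder transformation of a symmetric positive definite `K` at `t`: `K(t)` if
`μ(t) = 0`, and `Log (I + μ(t) K(t)) / μ(t)` if `μ(t) > 0`, with the principal logarithm (for the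
positive definite matrix `I + μ(t) K(t)`, the one given by the functional calculus). -/
noncomputable def cylinder {n : ℕ} (𝕋 : Set ℝ) (K : ℝ → Matrix (Fin n) (Fin n) ℝ) (t : ℝ) :
    Matrix (Fin n) (Fin n) ℝ :=
  if mu 𝕋 t = 0 then K t
  else (mu 𝕋 t)⁻¹ • cfc Real.log (1 + mu 𝕋 t • K t)

/-- The matrix exponential function `e_K(t, a)` on the time scale `𝕋`. -/
noncomputable def matrixExp {n : ℕ} (𝕋 : Set ℝ) (K : ℝ → Matrix (Fin n) (Fin n) ℝ) (t a : ℝ) :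
    Matrix (Fin n) (Fin n) ℝ :=
  NormedSpace.exp (Matrix.of fun i j => deltaIntegral 𝕋 (fun s => cylinder 𝕋 K s i j) a t)

/-- The order `M ≤ N` on square matrices: `zᵀ M z ≤ zᵀ N z` for all `z` (for symmetric matrices,
the Loewner order). -/
def FormLE {n : ℕ} (M N : Matrix (Fin n) (Fin n) ℝ) : Prop :=
  ∀ z : Fin n → ℝ, z ⬝ᵥ M.mulVec z ≤ z ⬝ᵥ N.mulVec z

/-- `X` solves `X^Δ = F(t, X)`, `X(a) = A` on `[a,b]_𝕋`, with values in `S`. -/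
structure IsSolutionIn {n : ℕ} (𝕋 : Set ℝ) (a b : ℝ) (S : Set (Matrix (Fin n) (Fin n) ℝ))
    (F : ℝ → Matrix (Fin n) (Fin n) ℝ → Matrix (Fin n) (Fin n) ℝ)
    (A : Matrix (Fin n) (Fin n) ℝ) (X : ℝ → Matrix (Fin n) (Fin n) ℝ) : Prop where
  initial : X a = A
  mem : ∀ t ∈ interval 𝕋 a b, X t ∈ S
  deriv : ∀ t ∈ kappa (interval 𝕋 a b),
    HasMatrixDeltaDerivAt (interval 𝕋 a b) X (F t (X t)) t

end TimeScale

/-! The trace turns the matrix problem into a scalar one. For comparable `P`, `Q`, put `D = P - Q`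
and let `E` be the difference of their derivatives. Testing the inverse Lipschitz condition on each
eigenvector of `E` bounds every eigenvalue of `E` by `tr B * tr D`, so `tr E ≤ n * tr B * tr D`
(`trace_le_of_formLE`). By rd-continuity `tr B` is bounded on the compact interval
(`RdContinuous.exists_le`), so `w = tr X - tr Y` satisfies `|w^Δ| ≤ C|w|` and `w(a) = 0`; Grönwall
(`eq_zero_of_abs_deltaDeriv_le`) gives `w = 0`. Distinct values of `X` and `Y` would differ by a
positive definite matrix, up to sign, whose trace is nonzero. -/

namespace TimeScale

/-! ### Trace bounds for positive definite matrices -/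

section Matrices

variable {n : ℕ}

/-- Cauchy–Schwarz on each row: the trace is the squared Frobenius norm of `R`. -/
theorem mulVec_dotProduct_self_le (R : Matrix (Fin n) (Fin n) ℝ) (v : Fin n → ℝ) :
    R.mulVec v ⬝ᵥ R.mulVec v ≤ (R.transpose * R).trace * (v ⬝ᵥ v) := by
  have h1 : (R.transpose * R).trace = ∑ i, ∑ j, R i j ^ 2 := by
    rw [Finset.sum_comm]
    simp [Matrix.trace, Matrix.mul_apply, sq]
  have h2 : v ⬝ᵥ v = ∑ j, v j ^ 2 := by simp [dotProduct, sq]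
  rw [h1, h2, Finset.sum_mul, dotProduct]
  refine Finset.sum_le_sum fun i _ => ?_
  rw [← sq]
  exact Finset.sum_mul_sq_le_sq_mul_sq Finset.univ (R i) v

open scoped MatrixOrder in
theorem exists_eq_transpose_mul_self {A : Matrix (Fin n) (Fin n) ℝ} (hA : A.PosDef) :
    ∃ R : Matrix (Fin n) (Fin n) ℝ, A = R.transpose * R := by
  obtain ⟨R, hR⟩ := CStarAlgebra.nonneg_iff_eq_star_mul_self.mp hA.posSemidef.nonneg
  exact ⟨R, by simpa [Matrix.star_eq_conjTranspose] using hR⟩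

theorem dotProduct_mulVec_transpose_mul_self (R : Matrix (Fin n) (Fin n) ℝ) (v : Fin n → ℝ) :
    v ⬝ᵥ (R.transpose * R).mulVec v = R.mulVec v ⬝ᵥ R.mulVec v := by
  rw [← Matrix.mulVec_mulVec, Matrix.dotProduct_mulVec, Matrix.vecMul_transpose]

/-- The quadratic form of a positive definite matrix is bounded by its trace. -/
theorem dotProduct_mulVec_le_trace {A : Matrix (Fin n) (Fin n) ℝ} (hA : A.PosDef)
    (v : Fin n → ℝ) : v ⬝ᵥ A.mulVec v ≤ A.trace * (v ⬝ᵥ v) := by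
  obtain ⟨R, rfl⟩ := exists_eq_transpose_mul_self hA
  rw [dotProduct_mulVec_transpose_mul_self]
  exact mulVec_dotProduct_self_le R v

/-- The inverse of a positive definite matrix is bounded below by the inverse of the trace. -/
theorem dotProduct_self_le_trace_mul_inv {A : Matrix (Fin n) (Fin n) ℝ} (hA : A.PosDef)
    (v : Fin n → ℝ) : v ⬝ᵥ v ≤ A.trace * (v ⬝ᵥ A⁻¹.mulVec v) := by
  have hdet : IsUnit A.det := hA.det_pos.ne'.isUnit
  -- With `v = A y` and `A = RᵀR`, the claim is the Frobenius bound for `Rᵀ` at the vector `R y`.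
  obtain ⟨y, rfl⟩ : ∃ y, v = A.mulVec y :=
    ⟨A⁻¹.mulVec v, by rw [Matrix.mulVec_mulVec, Matrix.mul_nonsing_inv A hdet, Matrix.one_mulVec]⟩
  rw [Matrix.mulVec_mulVec, Matrix.nonsing_inv_mul A hdet, Matrix.one_mulVec,
    dotProduct_comm (A.mulVec y) y]
  obtain ⟨R, rfl⟩ := exists_eq_transpose_mul_self hA
  rw [dotProduct_mulVec_transpose_mul_self, ← Matrix.mulVec_mulVec, Matrix.trace_mul_comm]
  simpa using mulVec_dotProduct_self_le R.transpose (R.mulVec y)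

/-- The inverse Lipschitz condition, tested on the eigenvectors of `E`, bounds the trace of `E`. -/
theorem trace_le_of_formLE {D E B : Matrix (Fin n) (Fin n) ℝ} (hD : D.PosDef) (hE : E.PosDef)
    (hB : B.PosDef) (h : FormLE D⁻¹ (E⁻¹ * B)) : E.trace ≤ n * B.trace * D.trace := by
  have hEdet : IsUnit E.det := hE.det_pos.ne'.isUnit
  have key : ∀ i, hE.1.eigenvalues i ≤ B.trace * D.trace := by
    intro i
    have hpos : 0 < hE.1.eigenvalues i := hE.eigenvalues_pos i
    set c := hE.1.eigenvalues i with hc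
    set z : Fin n → ℝ := ⇑(hE.1.eigenvectorBasis i) with hz
    have hz0 : z ≠ 0 := fun h0 => (hE.1.eigenvectorBasis.orthonormal.ne_zero i) (by
      ext j
      exact congrFun h0 j)
    have hzz : 0 < z ⬝ᵥ z :=
      lt_of_le_of_ne (by simpa using dotProduct_star_self_nonneg z)
        fun h0 => hz0 (dotProduct_self_eq_zero.mp h0.symm)
    have hEz : E.mulVec z = c • z := hE.1.mulVec_eigenvectorBasis i
    have hinv : E⁻¹.mulVec z = c⁻¹ • z := by
      have : z = c⁻¹ • E.mulVec z := by rw [hEz, smul_smul, inv_mul_cancel₀ hpos.ne', one_smul]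
      conv_lhs => rw [this]
      rw [Matrix.mulVec_smul, Matrix.mulVec_mulVec, Matrix.nonsing_inv_mul E hEdet,
        Matrix.one_mulVec]
    have hEt : E⁻¹.transpose = E⁻¹ := by
      have : E⁻¹.IsHermitian := hE.1.inv
      simpa [Matrix.IsHermitian] using this
    -- Since `E⁻¹` is symmetric, it can be moved onto the eigenvector `z`; `E⁻¹ * B` itself need not
    -- be symmetric.
    have h1 : z ⬝ᵥ (E⁻¹ * B).mulVec z = c⁻¹ * (z ⬝ᵥ B.mulVec z) := by
      rw [← Matrix.mulVec_mulVec, Matrix.dotProduct_mulVec, ← Matrix.mulVec_transpose, hEt, hinv,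
        smul_dotProduct, smul_eq_mul]
    have hDt : 0 ≤ D.trace := hD.posSemidef.trace_nonneg
    have h2 := h z
    rw [h1] at h2
    have h3 := dotProduct_self_le_trace_mul_inv hD z
    have h4 : c⁻¹ * (z ⬝ᵥ B.mulVec z) ≤ c⁻¹ * (B.trace * (z ⬝ᵥ z)) :=
      mul_le_mul_of_nonneg_left (dotProduct_mulVec_le_trace hB z) (inv_pos.mpr hpos).le
    have h5 : z ⬝ᵥ z ≤ D.trace * (c⁻¹ * (B.trace * (z ⬝ᵥ z))) :=
      h3.trans (mul_le_mul_of_nonneg_left (h2.trans h4) hDt)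
    have h6 : c * (z ⬝ᵥ z) ≤ B.trace * D.trace * (z ⬝ᵥ z) := by
      calc c * (z ⬝ᵥ z) ≤ c * (D.trace * (c⁻¹ * (B.trace * (z ⬝ᵥ z)))) :=
            mul_le_mul_of_nonneg_left h5 hpos.le
        _ = B.trace * D.trace * (z ⬝ᵥ z) := by field_simp
    exact le_of_mul_le_mul_right h6 hzz
  have htr : E.trace = ∑ i, hE.1.eigenvalues i := by
    simpa using hE.1.trace_eq_sum_eigenvalues
  calc E.trace ≤ ∑ _i : Fin n, B.trace * D.trace := by
        rw [htr]
        exact Finset.sum_le_sum fun i _ => key i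
    _ = n * B.trace * D.trace := by simp [mul_assoc]

end Matrices

/-! ### Jump operators and boundedness of rd-continuous functions -/

section JumpOperators

variable {T : Set ℝ} {t : ℝ}

theorem le_sigma (T : Set ℝ) (t : ℝ) : t ≤ sigma T t := by
  unfold sigma
  split_ifs with h
  · exact le_csInf h fun s hs => hs.2.le
  · exact le_rfl

theorem sigma_le {s : ℝ} (hs : s ∈ T) (hts : t < s) : sigma T t ≤ s := by
  unfold sigma
  rw [if_pos ⟨s, hs, hts⟩]
  exact csInf_le ⟨t, fun r hr => hr.2.le⟩ ⟨hs, hts⟩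

theorem le_rho {s : ℝ} (hs : s ∈ T) (hst : s < t) : s ≤ rho T t := by
  unfold rho
  rw [if_pos ⟨s, hs, hst⟩]
  exact le_csSup ⟨t, fun r hr => hr.2.le⟩ ⟨hs, hst⟩

theorem rho_le (T : Set ℝ) (t : ℝ) : rho T t ≤ t := by
  unfold rho
  split_ifs with h
  · exact csSup_le h fun s hs => hs.2.le
  · exact le_rfl

theorem sigma_mem (hT : IsClosed T) (ht : t ∈ T) : sigma T t ∈ T := by
  unfold sigma
  split_ifs with h
  · exact hT.closure_subset_iff.mpr inter_subset_left
      (csInf_mem_closure h ⟨t, fun r hr => hr.2.le⟩)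
  · exact ht

theorem mem_kappa_of_lt {s : ℝ} (ht : t ∈ T) (hs : s ∈ T) (hts : t < s) : t ∈ kappa T :=
  ⟨ht, fun h => (h.1.2 hs).not_gt hts⟩

theorem nhdsWithin_left_eq_bot (ht : t ∈ T) (h : ¬ LeftDense T t) : 𝓝[T ∩ Iio t] t = ⊥ := by
  by_cases hne : (T ∩ Iio t).Nonempty
  · have hlt : rho T t < t := lt_of_le_of_ne (rho_le T t) fun he => h ⟨ht, hne, he⟩
    refine Filter.empty_mem_iff_bot.mp
      (mem_of_superset (inter_mem_nhdsWithin _ (Ioi_mem_nhds hlt)) ?_)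
    rintro s ⟨⟨hs, hst⟩, hrs⟩
    exact (le_rho hs hst).not_gt hrs
  · rw [not_nonempty_iff_eq_empty.mp hne, nhdsWithin_empty]

theorem nhdsWithin_right_eq_bot (ht : t ∈ T) (h : ¬ RightDense T t) : 𝓝[T ∩ Ioi t] t = ⊥ := by
  by_cases hne : (T ∩ Ioi t).Nonempty
  · have hlt : t < sigma T t := lt_of_le_of_ne (le_sigma T t) fun he => h ⟨ht, hne, he.symm⟩
    refine Filter.empty_mem_iff_bot.mp
      (mem_of_superset (inter_mem_nhdsWithin _ (Iio_mem_nhds hlt)) ?_)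
    rintro s ⟨⟨hs, hst⟩, hrs⟩
    exact (sigma_le hs hst).not_gt hrs
  · rw [not_nonempty_iff_eq_empty.mp hne, nhdsWithin_empty]

/-- An rd-continuous real function on a compact time scale is bounded above. -/
theorem RdContinuous.exists_le {f : ℝ → ℝ} (hT : IsCompact T) (hf : RdContinuous T f) :
    ∃ C, ∀ t ∈ T, f t ≤ C := by
  refine hT.induction_on (p := fun A => ∃ C, ∀ t ∈ A, f t ≤ C) ⟨0, by simp⟩
    (fun A A' hAA' ⟨C, hC⟩ => ⟨C, fun t ht => hC t (hAA' ht)⟩)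
    (fun A A' ⟨C, hC⟩ ⟨C', hC'⟩ => ⟨max C C', fun t ht => ht.elim
      (fun h => (hC t h).trans (le_max_left _ _)) fun h => (hC' t h).trans (le_max_right _ _)⟩) ?_
  intro t ht
  -- By compactness a local bound suffices. The two sides and the point itself are bounded
  -- separately, as the left limit may differ from `f t`.
  have hl : ∃ C, ∀ᶠ s in 𝓝[T ∩ Iio t] t, f s ≤ C := by
    by_cases h : LeftDense T t
    · obtain ⟨l, hl⟩ := hf.2 t h
      exact ⟨l + 1, hl.eventually_le_const (lt_add_one l)⟩
    · exact ⟨0, by simp [nhdsWithin_left_eq_bot ht h]⟩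
  have hr : ∃ C, ∀ᶠ s in 𝓝[T ∩ Ioi t] t, f s ≤ C := by
    by_cases h : RightDense T t
    · exact ⟨f t + 1, ((hf.1 t h).mono inter_subset_left).eventually_le_const (lt_add_one _)⟩
    · exact ⟨0, by simp [nhdsWithin_right_eq_bot ht h]⟩
  obtain ⟨C, hC⟩ := hl
  obtain ⟨C', hC'⟩ := hr
  refine ⟨{s | f s ≤ max (f t) (max C C')}, ?_, _, fun s hs => hs⟩
  rw [eventually_nhdsWithin_iff] at hC hC'
  change ∀ᶠ s in 𝓝[T] t, f s ≤ max (f t) (max C C')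
  rw [eventually_nhdsWithin_iff]
  filter_upwards [hC, hC'] with s h1 h2 hs
  rcases lt_trichotomy s t with h | rfl | h
  · exact (h1 ⟨hs, h⟩).trans (by simp)
  · simp
  · exact (h2 ⟨hs, h⟩).trans (by simp)

end JumpOperators

/-! ### Delta derivatives and Grönwall's lemma -/

section DeltaDerivative

variable {T : Set ℝ} {x y : ℝ → ℝ} {d e t : ℝ}

theorem HasDeltaDerivAt.add (hx : HasDeltaDerivAt T x d t) (hy : HasDeltaDerivAt T y e t) :
    HasDeltaDerivAt T (fun s => x s + y s) (d + e) t := by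
  intro ε hε
  obtain ⟨δ₁, hδ₁, h₁⟩ := hx (ε / 2) (half_pos hε)
  obtain ⟨δ₂, hδ₂, h₂⟩ := hy (ε / 2) (half_pos hε)
  refine ⟨min δ₁ δ₂, lt_min hδ₁ hδ₂, fun s hs hst => ?_⟩
  have k₁ := h₁ s hs (hst.trans_le (min_le_left _ _))
  have k₂ := h₂ s hs (hst.trans_le (min_le_right _ _))
  calc |(x (sigma T t) + y (sigma T t) - (x s + y s)) - (d + e) * (sigma T t - s)|
      = |((x (sigma T t) - x s) - d * (sigma T t - s)) +
          ((y (sigma T t) - y s) - e * (sigma T t - s))| := by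
        congr 1
        ring
    _ ≤ _ := abs_add_le _ _
    _ ≤ ε * |sigma T t - s| := by linarith

theorem HasDeltaDerivAt.neg (hx : HasDeltaDerivAt T x d t) :
    HasDeltaDerivAt T (fun s => -x s) (-d) t := by
  intro ε hε
  obtain ⟨δ, hδ, h⟩ := hx ε hε
  refine ⟨δ, hδ, fun s hs hst => ?_⟩
  rw [← abs_neg]
  convert h s hs hst using 2
  ring

theorem HasDeltaDerivAt.sum {ι : Type*} {u : Finset ι} {x : ι → ℝ → ℝ} {d : ι → ℝ}
    (h : ∀ i ∈ u, HasDeltaDerivAt T (x i) (d i) t) :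
    HasDeltaDerivAt T (fun s => ∑ i ∈ u, x i s) (∑ i ∈ u, d i) t := by
  classical
  induction u using Finset.induction_on with
  | empty => exact fun ε hε => ⟨1, one_pos, fun s _ _ => by simp; positivity⟩
  | insert i u hi ih =>
    simp only [Finset.sum_insert hi]
    exact (h i (Finset.mem_insert_self i u)).add
      (ih fun j hj => h j (Finset.mem_insert_of_mem hj))

theorem HasMatrixDeltaDerivAt.trace {n : ℕ} {X : ℝ → Matrix (Fin n) (Fin n) ℝ}
    {D : Matrix (Fin n) (Fin n) ℝ} (h : HasMatrixDeltaDerivAt T X D t) :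
    HasDeltaDerivAt T (fun s => (X s).trace) D.trace t :=
  HasDeltaDerivAt.sum fun i _ => h i i

/-- The point `s = t` is admissible in the definition for every `ε`, so the error there vanishes. -/
theorem HasDeltaDerivAt.apply_sigma (ht : t ∈ T) (hx : HasDeltaDerivAt T x d t) :
    x (sigma T t) = x t + d * (sigma T t - t) := by
  have h0 : |(x (sigma T t) - x t) - d * (sigma T t - t)| ≤ 0 := by
    refine le_of_forall_pos_le_add fun ε hε => ?_
    have hpos : 0 < |sigma T t - t| + 1 := by positivity
    obtain ⟨δ, hδ, h⟩ := hx (ε / (|sigma T t - t| + 1)) (div_pos hε hpos)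
    refine (h t ht (by simpa using hδ)).trans ?_
    rw [zero_add, div_mul_eq_mul_div, div_le_iff₀ hpos]
    nlinarith [abs_nonneg (sigma T t - t)]
  have := abs_nonpos_iff.mp h0
  linarith

theorem HasDeltaDerivAt.continuousWithinAt (ht : t ∈ T) (hx : HasDeltaDerivAt T x d t) :
    ContinuousWithinAt x T t := by
  have hσ := hx.apply_sigma ht
  rw [Metric.continuousWithinAt_iff]
  intro ε hε
  have hpos : 0 < |sigma T t - t| + 1 := by positivity
  obtain ⟨δ, hδ, h⟩ := hx (ε / (|sigma T t - t| + 1) / 2) (by positivity)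
  refine ⟨min δ (min 1 (ε / (|d| + 1) / 2)), by positivity, fun s hs hst => ?_⟩
  rw [Real.dist_eq] at hst ⊢
  have h1 := h s hs (hst.trans_le (min_le_left _ _))
  have h2 : |s - t| < 1 := hst.trans_le ((min_le_right _ _).trans (min_le_left _ _))
  have h3 : |s - t| < ε / (|d| + 1) / 2 :=
    hst.trans_le ((min_le_right _ _).trans (min_le_right _ _))
  have h4 : |sigma T t - s| ≤ |sigma T t - t| + 1 := by
    have := abs_sub_le (sigma T t) t s
    rw [abs_sub_comm t s] at this
    linarith
  have h5 : ε / (|sigma T t - t| + 1) / 2 * |sigma T t - s| ≤ ε / 2 := by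
    calc _ ≤ ε / (|sigma T t - t| + 1) / 2 * (|sigma T t - t| + 1) := by gcongr
      _ = ε / 2 := by field_simp
  have h6 : |d| * |s - t| < ε / 2 := by
    have hd : 0 < |d| + 1 := by positivity
    calc |d| * |s - t| ≤ (|d| + 1) * |s - t| := by gcongr; linarith
      _ < (|d| + 1) * (ε / (|d| + 1) / 2) := by gcongr
      _ = ε / 2 := by field_simp
  have h7 : x s - x t = -((x (sigma T t) - x s) - d * (sigma T t - s)) + d * (s - t) := by
    rw [hσ]
    ring
  rw [h7]
  refine (abs_add_le _ _).trans_lt ?_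
  rw [abs_neg, abs_mul]
  linarith

/-- Grönwall's lemma on a compact time scale, with zero initial value. -/
theorem eq_zero_of_abs_deltaDeriv_le {a b C : ℝ} (hT : IsClosed T) (haT : a ∈ T)
    (hbT : b ∈ T) (hTab : T ⊆ Icc a b) (hC : 0 ≤ C) {w w' : ℝ → ℝ} (h0 : w a = 0)
    (hw : ∀ t ∈ kappa T, HasDeltaDerivAt T w (w' t) t)
    (hle : ∀ t ∈ kappa T, |w' t| ≤ C * |w t|) : ∀ t ∈ T, w t = 0 := by
  have main : ∀ ε > 0, ∀ t ∈ T, |w t| ≤ ε * Real.exp ((C + 1) * (t - a)) := by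
    intro ε hε
    -- A barrier: the rate exceeds `C` by 1 to leave room for the differentiation error at
    -- right-dense points.
    set G : ℝ → ℝ := fun t => ε * Real.exp ((C + 1) * (t - a)) with hG
    have hGpos : ∀ t, 0 < G t := fun t => by positivity
    have hGstep : ∀ t s, G t * (1 + (C + 1) * (s - t)) ≤ G s := by
      intro t s
      have h1 : G s = G t * Real.exp ((C + 1) * (s - t)) := by
        simp only [hG]
        rw [mul_assoc, ← Real.exp_add]
        ring_nf
      rw [h1]
      refine mul_le_mul_of_nonneg_left ?_ (hGpos t).le
      linarith [Real.add_one_le_exp ((C + 1) * (s - t))]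
    -- Induction along `T`: the supremum of this initial segment belongs to it and cannot lie before
    -- `b`.
    set U : Set ℝ := {t | t ∈ T ∧ ∀ s ∈ T, s ≤ t → |w s| ≤ G s} with hU
    have haU : a ∈ U := ⟨haT, fun s hs hsa => by
      rw [le_antisymm hsa (hTab hs).1, h0, abs_zero]
      exact (hGpos a).le⟩
    have hUb : BddAbove U := ⟨b, fun t ht => (hTab ht.1).2⟩
    set c := sSup U with hc
    have hcT : c ∈ T := hT.closure_subset_iff.mpr (fun t ht => ht.1)
      (csSup_mem_closure ⟨a, haU⟩ hUb)
    have hbelow : ∀ s ∈ T, s < c → |w s| ≤ G s := by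
      intro s hs hsc
      obtain ⟨t, ht, hst⟩ := exists_lt_of_lt_csSup ⟨a, haU⟩ hsc
      exact ht.2 s hs hst.le
    have hcG : |w c| ≤ G c := by
      by_cases hcU : c ∈ U
      · exact hcU.2 c hcT le_rfl
      -- A supremum that is not attained is left-dense, hence in `kappa T`, where `w` is continuous.
      have hac : a < c := lt_of_le_of_ne (le_csSup hUb haU) fun h => hcU (h ▸ haU)
      have hfreq : ∀ r < c, ∃ s ∈ T, r < s ∧ s < c := by
        intro r hr
        obtain ⟨s, hs, hrs⟩ := exists_lt_of_lt_csSup ⟨a, haU⟩ hr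
        exact ⟨s, hs.1, hrs, lt_of_le_of_ne (le_csSup hUb hs) fun h => hcU (h ▸ hs)⟩
      have hck : c ∈ kappa T := by
        refine ⟨hcT, fun h => ?_⟩
        obtain ⟨s, hs, h1, h2⟩ := hfreq _ h.2
        exact (le_rho hs h2).not_gt h1
      have hcont : ContinuousWithinAt w (T ∩ Iio c) c :=
        ((hw c hck).continuousWithinAt hcT).mono inter_subset_left
      have hGc : Continuous G := by fun_prop
      have : (𝓝[T ∩ Iio c] c).NeBot := by
        rw [← mem_closure_iff_nhdsWithin_neBot, Metric.mem_closure_iff]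
        intro δ hδ
        obtain ⟨s, hs, h1, h2⟩ := hfreq (c - δ) (by linarith)
        refine ⟨s, ⟨hs, h2⟩, ?_⟩
        rw [Real.dist_eq, abs_of_pos (by linarith)]
        linarith
      refine le_of_tendsto_of_tendsto hcont.abs hGc.continuousWithinAt.tendsto ?_
      filter_upwards [self_mem_nhdsWithin] with s hs using hbelow s hs.1 hs.2
    have hcU : c ∈ U := ⟨hcT, fun s hs hsc => by
      rcases hsc.lt_or_eq with h | rfl
      · exact hbelow s hs h
      · exact hcG⟩
    have hcb : c = b := by
      by_contra hne
      have hcb : c < b := lt_of_le_of_ne (hTab hcT).2 hne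
      have hck : c ∈ kappa T := mem_kappa_of_lt hcT hbT hcb
      have hwc := hw c hck
      have hdc := hle c hck
      rcases (le_sigma T c).lt_or_eq with hσ | hσ
      · have hσU : sigma T c ∈ U := by
          refine ⟨sigma_mem hT hcT, fun s hs hsσ => ?_⟩
          rcases le_or_gt s c with h | h
          · exact hcU.2 s hs h
          · rw [le_antisymm hsσ (sigma_le hs h), hwc.apply_sigma hcT]
            refine le_trans ?_ (hGstep c (sigma T c))
            have hμ : 0 < sigma T c - c := sub_pos.mpr hσ
            have h1 := abs_add_le (w c) (w' c * (sigma T c - c))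
            rw [abs_mul, abs_of_pos hμ] at h1
            have h2 : |w' c| ≤ (C + 1) * G c :=
              hdc.trans (mul_le_mul (by linarith) hcG (abs_nonneg _) (by linarith))
            nlinarith [mul_le_mul_of_nonneg_right h2 hμ.le]
        exact (le_csSup hUb hσU).not_gt hσ
      -- At a right-dense point the tolerance `G c` uses up exactly the spare 1 in the rate `C + 1`.
      · obtain ⟨δ, hδ, h⟩ := hwc (G c) (hGpos c)
        rw [← hσ] at h
        obtain ⟨r, ⟨hrT, hcr⟩, hrδ⟩ : ∃ r ∈ T ∩ Ioi c, r < c + δ := by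
          have hne : (T ∩ Ioi c).Nonempty := ⟨b, hbT, hcb⟩
          refine exists_lt_of_csInf_lt hne ?_
          have : sInf (T ∩ Ioi c) = c := by
            have h1 := hσ
            unfold sigma at h1
            rw [if_pos hne] at h1
            exact h1.symm
          linarith
        have hrU : r ∈ U := by
          refine ⟨hrT, fun s hs hsr => ?_⟩
          rcases le_or_gt s c with hsc | hsc
          · exact hcU.2 s hs hsc
          have hμ : 0 < s - c := sub_pos.mpr hsc
          have h1 := h s hs (by rw [abs_of_pos hμ]; linarith)
          rw [abs_sub_comm c s, abs_of_pos hμ] at h1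
          refine le_trans ?_ (hGstep c s)
          have h2 : w s = w c + w' c * (s - c) + -((w c - w s) - w' c * (c - s)) := by ring
          have h3 : |w s| ≤ |w c| + |w' c| * (s - c) + G c * (s - c) := by
            rw [h2]
            refine (abs_add_le _ _).trans (add_le_add ((abs_add_le _ _).trans ?_) ?_)
            · rw [abs_mul, abs_of_pos hμ]
            · rwa [abs_neg]
          have h4 : |w' c| ≤ C * G c := hdc.trans (mul_le_mul_of_nonneg_left hcG hC)
          nlinarith [mul_le_mul_of_nonneg_right h4 hμ.le]
        exact (le_csSup hUb hrU).not_gt hcr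
    intro t ht
    exact hcU.2 t ht (hcb ▸ (hTab ht).2)
  intro t ht
  refine abs_nonpos_iff.mp (le_of_forall_pos_le_add fun ε hε => ?_)
  have h := main (ε / Real.exp ((C + 1) * (t - a))) (by positivity) t ht
  rwa [div_mul_cancel₀ _ (Real.exp_pos _).ne', ← zero_add ε] at h

end DeltaDerivative

end TimeScale

/-! ### Uniqueness of the solution -/

theorem mainTheorem8 (n : ℕ) (𝕋 : Set ℝ) (h𝕋 : IsClosed 𝕋) (a b : ℝ)
    (ha : a ∈ 𝕋) (hb : b ∈ 𝕋) (hab : a < b)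
    (S : Set (Matrix (Fin n) (Fin n) ℝ))
    (F : ℝ → Matrix (Fin n) (Fin n) ℝ → Matrix (Fin n) (Fin n) ℝ)
    (hF : TimeScale.RightHilgerContinuous (TimeScale.interval 𝕋 a b) S F)
    (B : ℝ → Matrix (Fin n) (Fin n) ℝ)
    (hBpos : ∀ t ∈ TimeScale.interval 𝕋 a b, (B t).PosDef)
    -- condition (1)
    (hBrd : TimeScale.RdContinuous (TimeScale.interval 𝕋 a b) B)
    -- condition (2)
    (hcommB : ∀ t ∈ TimeScale.interval 𝕋 a b,
      Commute (TimeScale.matrixExp (TimeScale.interval 𝕋 a b) B t a) (B t))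
    (hcommS : ∀ t ∈ TimeScale.interval 𝕋 a b, ∀ P ∈ S,
      Commute (TimeScale.matrixExp (TimeScale.interval 𝕋 a b) B t a) P)
    -- of any two different members of `S`, one minus the other is positive definite
    (hpos : ∀ P ∈ S, ∀ Q ∈ S, P ≠ Q → (P - Q).PosDef ∨ (Q - P).PosDef)
    -- the difference is increasing: its delta derivative `F(t,P) - F(t,Q)` is positive definite
    (hinc : ∀ t ∈ TimeScale.kappa (TimeScale.interval 𝕋 a b), ∀ P ∈ S, ∀ Q ∈ S,
      (P - Q).PosDef → (F t P - F t Q).PosDef)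
    -- inverse Lipschitz condition
    (hinv : ∀ t ∈ TimeScale.kappa (TimeScale.interval 𝕋 a b), ∀ P ∈ S, ∀ Q ∈ S,
      (P - Q).PosDef → TimeScale.FormLE (P - Q)⁻¹ ((F t P - F t Q)⁻¹ * B t))
    (A : Matrix (Fin n) (Fin n) ℝ) (X Y : ℝ → Matrix (Fin n) (Fin n) ℝ)
    (hX : TimeScale.IsSolutionIn 𝕋 a b S F A X)
    (hY : TimeScale.IsSolutionIn 𝕋 a b S F A Y) :
    ∀ t ∈ TimeScale.interval 𝕋 a b, X t = Y t := by

  have hT : IsClosed (TimeScale.interval 𝕋 a b) := h𝕋.inter isClosed_Icc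
  have hTc : IsCompact (TimeScale.interval 𝕋 a b) := isCompact_Icc.inter_left h𝕋
  have htr : Continuous (Matrix.trace : Matrix (Fin n) (Fin n) ℝ → ℝ) := continuous_id.matrix_trace
  obtain ⟨K, hK⟩ := TimeScale.RdContinuous.exists_le (f := fun t => (B t).trace) hTc
    ⟨fun t ht => htr.continuousAt.comp_continuousWithinAt (hBrd.1 t ht), fun t ht =>
      (hBrd.2 t ht).imp' Matrix.trace fun l hl => (htr.tendsto l).comp hl⟩
  have hlip : ∀ t ∈ TimeScale.kappa (TimeScale.interval 𝕋 a b), ∀ P ∈ S, ∀ Q ∈ S,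
      (P - Q).PosDef →
        |(F t P).trace - (F t Q).trace| ≤ n * |K| * |P.trace - Q.trace| := by
    intro t ht P hP Q hQ hPQ
    have hE := hinc t ht P hP Q hQ hPQ
    have h := TimeScale.trace_le_of_formLE hPQ hE (hBpos t ht.1) (hinv t ht P hP Q hQ hPQ)
    have hD0 := hPQ.posSemidef.trace_nonneg
    have hE0 := hE.posSemidef.trace_nonneg
    rw [← Matrix.trace_sub, ← Matrix.trace_sub, abs_of_nonneg hD0, abs_of_nonneg hE0]
    refine h.trans ?_
    gcongr
    exact (hK t ht.1).trans (le_abs_self K)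
  have hzero := TimeScale.eq_zero_of_abs_deltaDeriv_le hT (C := n * |K|)
    (w := fun t => (X t).trace + -(Y t).trace)
    (w' := fun t => (F t (X t)).trace + -(F t (Y t)).trace)
    ⟨ha, le_rfl, hab.le⟩ ⟨hb, hab.le, le_rfl⟩ inter_subset_right (by positivity)
    (by simp [hX.initial, hY.initial])
    (fun t ht => (hX.deriv t ht).trace.add (hY.deriv t ht).trace.neg)
    (fun t ht => by
      simp only [← sub_eq_add_neg]
      -- Which solution is larger may depend on `t`; the absolute values make the estimate
      -- symmetric.
      by_cases heq : X t = Y t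
      · simp [heq]
      · rcases hpos _ (hX.mem t ht.1) _ (hY.mem t ht.1) heq with h | h
        · exact hlip t ht _ (hX.mem t ht.1) _ (hY.mem t ht.1) h
        · rw [abs_sub_comm, abs_sub_comm (X t).trace]
          exact hlip t ht _ (hY.mem t ht.1) _ (hX.mem t ht.1) h)
  intro t ht
  by_contra hne
  -- Positivity of the trace fails for `n = 0`, where all matrices coincide anyway.
  have : Nonempty (Fin n) := by
    by_contra hemp
    rw [not_nonempty_iff] at hemp
    exact hne (Subsingleton.elim _ _)
  have hz : (X t).trace + -(Y t).trace = 0 := hzero t ht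
  rcases hpos _ (hX.mem t ht) _ (hY.mem t ht) hne with h | h
  · have := h.trace_pos
    rw [Matrix.trace_sub] at this
    linarith
  · have := h.trace_pos
    rw [Matrix.trace_sub] at this
    linarith
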